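/- Let $A$ be a unital $C^*$-algebra and let $B$ be a unital complex Banach algebra which is semisimple, i.e. its Jacobson radical is zero. Let $T\colon A\to B$ be a surjective linear map which is spectrally bounded, i.e. there is a constant $M\ge 0$ such that $r(Tx)\le M\,r(x)$ for all $x\in A$, where $r$ denotes the spectral radius. Let $p,q\in A$ be mutually orthogonal (i.e. $pq=0$) properly infinite projections, where a projection $p=p^*=p^2\neq 0$ is called properly infinite if there are projections $e,f\in A$ with $e\le p$, $f\le p$, $ef=0$ and elements $u,v\in A$ with $u^*u=v^*v=p$, $uu^*=e$, $vv^*=f$. Then $$(Ta)(Tb)+(Tb)(Ta)=0\qquad\text{for all } a\in pAp \text{ and } b\in qAq.$$ -/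

import Mathlib

/-- A linear map `T` between complex Banach algebras is spectrally bounded if there is a constant
`M ≥ 0` with `r(T x) ≤ M r(x)` for all `x`, where `r` is the spectral radius. -/
def IsSpectrallyBounded {A B : Type*} [NormedRing A] [NormedAlgebra ℂ A]
    [NormedRing B] [NormedAlgebra ℂ B] (T : A →ₗ[ℂ] B) : Prop :=
  ∃ M : NNReal, ∀ x : A, spectralRadius ℂ (T x) ≤ (M : ENNReal) * spectralRadius ℂ x

/-- Murray-von Neumann equivalence of projections: `p = v⋆ v` and `q = v v⋆` for some `v`. -/
def MurrayVonNeumannEquiv {A : Type*} [Mul A] [Star A] (p q : A) : Prop :=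
  ∃ v : A, star v * v = p ∧ v * star v = q

/-- A non-zero projection `p` is properly infinite if there are mutually orthogonal
subprojections `e` and `f` of `p`, both Murray-von Neumann equivalent to `p`.
For projections, `e ≤ p` means `p * e = e`. -/
structure IsProperlyInfiniteProjection {A : Type*} [CStarAlgebra A] (p : A) : Prop where
  isStarProjection : IsStarProjection p
  ne_zero : p ≠ 0
  exists_orthogonal : ∃ e f : A, IsStarProjection e ∧ IsStarProjection f ∧
    p * e = e ∧ p * f = f ∧ e * f = 0 ∧
    MurrayVonNeumannEquiv p e ∧ MurrayVonNeumannEquiv p f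

/-! Two facts combine. (i) `T` preserves square-zero elements. (ii) The corner of a properly
infinite projection is linearly spanned by its square-zero elements. Given these, for square-zero
`x` in `pAp` and `y` in `qAq` the sum `x + y` also has square zero, and expanding `(T x + T y) ^ 2 =
0` leaves the anticommutator; bilinearity does the rest.

For (i), let `a * a = 0` and `b = T a`. Since `(a + l x) ^ 2 = O(l)`, the spectral radius grows only
like `|l| ^ (1/2)` on complex lines through `b`. Liouville and maximum principles for the spectral
radius turn this into `r(k b + q) ≤ r(q)` for every commutator `q = b y - y b` and every `k`, and
then into `r(q b) = 0` (`srad_commutator_mul_self`). A density-type argument on simple modules shows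
that `b * b` acts as zero, so it lies in the radical.

For (ii), `x - g x h` is a combination of square-zero elements under mild relations, so conjugates
by isometries with orthogonal ranges agree modulo the span. A fixed-point equation, solved by a
Neumann series, forces `v y v⋆` itself into the span; a Peirce decomposition concludes. -/

/-! ### Spectral radius: semicontinuity, maximum principle, Liouville theorem. -/

section SpectralRadius

open Filter Topology Metric

variable {B : Type*} [NormedRing B] [NormedAlgebra ℂ B]

/-- The spectral radius as a real number. -/
noncomputable def srad (x : B) : ℝ := (spectralRadius ℂ x).toReal

theorem srad_nonneg (x : B) : 0 ≤ srad x := ENNReal.toReal_nonneg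

theorem srad_le {x : B} {c : ℝ} (hc : 0 ≤ c) (h : ∀ k ∈ spectrum ℂ x, ‖k‖ ≤ c) :
    srad x ≤ c := by
  refine ENNReal.toReal_le_of_le_ofReal hc (iSup₂_le fun k hk => ?_)
  exact (ofReal_norm k).symm.trans_le (ENNReal.ofReal_le_ofReal (h k hk))

theorem srad_le_of_isUnit {x : B} {c : ℝ} (hc : 0 ≤ c)
    (h : ∀ k : ℂ, c < ‖k‖ → IsUnit (algebraMap ℂ B k - x)) : srad x ≤ c :=
  srad_le hc fun k hk => not_lt.1 fun hck => hk (h k hck)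

variable [CompleteSpace B]

theorem spectralRadius_ne_top (x : B) : spectralRadius ℂ x ≠ ⊤ := by
  have h := spectrum.spectralRadius_le_pow_nnnorm_pow_one_div ℂ x 0
  refine ne_top_of_le_ne_top ?_ h
  simp [ENNReal.mul_eq_top]

theorem ofReal_srad (x : B) : ENNReal.ofReal (srad x) = spectralRadius ℂ x :=
  ENNReal.ofReal_toReal (spectralRadius_ne_top x)

theorem norm_le_srad {x : B} {k : ℂ} (hk : k ∈ spectrum ℂ x) : ‖k‖ ≤ srad x := by
  have h : (‖k‖₊ : ENNReal) ≤ spectralRadius ℂ x :=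
    le_iSup₂ (f := fun k (_ : k ∈ spectrum ℂ x) => (‖k‖₊ : ENNReal)) k hk
  simpa [srad] using ENNReal.toReal_mono (spectralRadius_ne_top x) h

theorem isUnit_of_srad_lt {x : B} {k : ℂ} (h : srad x < ‖k‖) :
    IsUnit (algebraMap ℂ B k - x) := by
  by_contra hk
  exact absurd (norm_le_srad (spectrum.mem_iff.2 hk)) (not_le.2 h)

theorem srad_comm (x y : B) : srad (x * y) = srad (y * x) := by
  have key : ∀ x y : B, srad (x * y) ≤ srad (y * x) := fun x y => by
    refine srad_le (srad_nonneg _) fun k hk => ?_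
    rcases eq_or_ne k 0 with rfl | h0
    · simpa using srad_nonneg _
    · have : k ∈ spectrum ℂ (x * y) \ {0} := ⟨hk, h0⟩
      rw [spectrum.nonzero_mul_comm] at this
      exact norm_le_srad this.1
  exact le_antisymm (key x y) (key y x)

theorem srad_conj (u : Bˣ) (x : B) : srad (↑u⁻¹ * x * u) = srad x := by
  rw [srad_comm]; simp

theorem srad_smul (k : ℂ) (x : B) : srad (k • x) = ‖k‖ * srad x := by
  have key : ∀ (k : ℂ), k ≠ 0 → ∀ x : B, srad (k • x) ≤ ‖k‖ * srad x := fun k hk x => by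
    refine srad_le_of_isUnit (by positivity [srad_nonneg x]) fun l hl => ?_
    have h1 : srad x < ‖k⁻¹ * l‖ := by
      rw [norm_mul, norm_inv, lt_inv_mul_iff₀ (norm_pos_iff.2 hk)]; exact hl
    have h2 := (isUnit_of_srad_lt h1).smul (Units.mk0 k hk)
    convert h2 using 1
    rw [Units.smul_mk0, smul_sub, Algebra.algebraMap_eq_smul_one, Algebra.algebraMap_eq_smul_one,
      smul_smul, mul_inv_cancel_left₀ hk]
  rcases eq_or_ne k 0 with rfl | hk
  · have : srad (0 : B) ≤ 0 := by
      refine srad_le_of_isUnit le_rfl fun k hk => ?_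
      rw [sub_zero]
      exact (IsUnit.mk0 k (norm_pos_iff.1 hk)).map _
    simpa using le_antisymm this (srad_nonneg _)
  · refine le_antisymm (key k hk x) ?_
    have := key k⁻¹ (inv_ne_zero hk) (k • x)
    rwa [smul_smul, inv_mul_cancel₀ hk, one_smul, norm_inv, le_inv_mul_iff₀ (norm_pos_iff.2 hk)]
      at this

theorem srad_neg (x : B) : srad (-x) = srad x := by
  simpa using srad_smul (-1) x

theorem srad_pow (x : B) {n : ℕ} (hn : n ≠ 0) : srad (x ^ n) = srad x ^ n := by
  apply le_antisymm
  · refine srad_le (by positivity [srad_nonneg x]) fun k hk => ?_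
    rw [spectrum.map_pow_of_pos x (Nat.pos_of_ne_zero hn)] at hk
    obtain ⟨l, hl, rfl⟩ := hk
    simpa using pow_le_pow_left₀ (norm_nonneg l) (norm_le_srad hl) n
  · have h := spectrum.spectralRadius_pow_le (𝕜 := ℂ) x n hn
    simpa [srad] using ENNReal.toReal_mono (spectralRadius_ne_top (x ^ n)) h

theorem srad_le_norm (x : B) : srad x ≤ ‖x‖ := by
  refine srad_le_of_isUnit (norm_nonneg x) fun k hk => ?_
  have hk0 : k ≠ 0 := norm_pos_iff.1 ((norm_nonneg x).trans_lt hk)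
  have h1 : ‖k⁻¹ • x‖ < 1 := by
    rw [norm_smul, norm_inv, inv_mul_lt_iff₀ (norm_pos_iff.2 hk0)]; simpa using hk
  have h2 := (isUnit_one_sub_of_norm_lt_one h1).smul (Units.mk0 k hk0)
  convert h2 using 1
  rw [Units.smul_mk0, smul_sub, Algebra.algebraMap_eq_smul_one, smul_smul,
    mul_inv_cancel₀ hk0, one_smul]

theorem srad_le_of_norm_pow_le {x : B} {c : ℝ} (hc : 0 ≤ c) {n : ℕ} (hn : n ≠ 0)
    (h : ‖x ^ n‖ ≤ c ^ n) : srad x ≤ c := by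
  have h1 := (srad_le_norm (x ^ n)).trans h
  rw [srad_pow x hn] at h1
  exact le_of_pow_le_pow_left₀ hn hc h1

theorem eventually_norm_pow_lt {x : B} {c : ℝ} (h : srad x < c) :
    ∀ᶠ n : ℕ in atTop, ‖x ^ n‖ < c ^ n := by
  have hc : 0 < c := (srad_nonneg x).trans_lt h
  have h1 : spectralRadius ℂ x < ENNReal.ofReal c := by
    rw [← ofReal_srad]; exact (ENNReal.ofReal_lt_ofReal_iff hc).2 h
  have h2 := (spectrum.pow_norm_pow_one_div_tendsto_nhds_spectralRadius x).eventually_lt_const h1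
  filter_upwards [h2, eventually_gt_atTop 0] with n hn hn0
  have h3 : ‖x ^ n‖ ^ (1 / n : ℝ) < c := (ENNReal.ofReal_lt_ofReal_iff hc).1 hn
  have h4 := pow_lt_pow_left₀ h3 (by positivity) hn0.ne'
  rwa [← Real.rpow_natCast, ← Real.rpow_mul (norm_nonneg _), one_div,
    inv_mul_cancel₀ (by exact_mod_cast hn0.ne'), Real.rpow_one] at h4

/-- Upper semicontinuity: a single power with `‖F w ^ n‖ < c ^ n` witnesses the bound, and this is
an open condition. -/
theorem eventually_srad_le {X : Type*} [TopologicalSpace X] {F : X → B} {s : Set X} {w : X}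
    (hF : ContinuousWithinAt F s w) {c : ℝ} (h : srad (F w) < c) :
    ∀ᶠ z in 𝓝[s] w, srad (F z) ≤ c := by
  obtain ⟨n, hn, hn0⟩ := ((eventually_norm_pow_lt h).and (eventually_ne_atTop 0)).exists
  filter_upwards [(hF.pow n).norm.eventually_lt_const hn] with z hz
  exact srad_le_of_norm_pow_le ((srad_nonneg _).trans h.le) hn0 hz.le

/-- The maximum principle for the spectral radius of a holomorphic function. -/
theorem srad_le_of_forall_mem_frontier {F : ℂ → B} {U : Set ℂ} (hU : Bornology.IsBounded U)
    (hF : DiffContOnCl ℂ F U) {c : ℝ} (hc : 0 ≤ c) (h : ∀ z ∈ frontier U, srad (F z) ≤ c)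
    {z : ℂ} (hz : z ∈ closure U) : srad (F z) ≤ c := by
  refine le_of_forall_gt_imp_ge_of_dense fun d hd => ?_
  have hd0 : 0 < d := hc.trans_lt hd
  have hcomp : IsCompact (frontier U) :=
    isCompact_of_isClosed_isBounded isClosed_frontier (hU.closure.subset frontier_subset_closure)
  have hcont : ContinuousOn F (frontier U) := hF.continuousOn.mono frontier_subset_closure
  -- A Dini-type argument: along the exponents `2 ^ n` the bound is inherited from `n` to `n + 1` by
  -- submultiplicativity, so compactness yields one exponent valid on the whole frontier.
  have key : ∃ N : ℕ, ∀ n ≥ N, ∀ w ∈ frontier U, ‖F w ^ 2 ^ n‖ ≤ d ^ 2 ^ n := by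
    refine hcomp.induction_on (p := fun s => ∃ N : ℕ, ∀ n ≥ N, ∀ w ∈ s,
      ‖F w ^ 2 ^ n‖ ≤ d ^ 2 ^ n) ⟨0, by simp⟩ ?_ ?_ ?_
    · rintro s t hst ⟨N, hN⟩
      exact ⟨N, fun n hn w hw => hN n hn w (hst hw)⟩
    · rintro s t ⟨N, hN⟩ ⟨M, hM⟩
      refine ⟨max N M, fun n hn w hw => ?_⟩
      rcases hw with hw | hw
      · exact hN n ((le_max_left _ _).trans hn) w hw
      · exact hM n ((le_max_right _ _).trans hn) w hw
    · intro w hw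
      have h1 : ∀ᶠ n : ℕ in atTop, ‖F w ^ 2 ^ n‖ < d ^ 2 ^ n :=
        (tendsto_pow_atTop_atTop_of_one_lt one_lt_two).eventually
          (eventually_norm_pow_lt ((h w hw).trans_lt hd))
      obtain ⟨N, hN⟩ := h1.exists
      refine ⟨{v | ‖F v ^ 2 ^ N‖ < d ^ 2 ^ N},
        
        (show ContinuousWithinAt (fun v => ‖F v ^ 2 ^ N‖) (frontier U) w from
          ((hcont w hw).pow _).norm).eventually_lt_const hN, N, fun n hn v hv => ?_⟩
      induction n, hn using Nat.le_induction with
      | base => exact le_of_lt hv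
      | succ n _ ih =>
        rw [pow_succ 2 n, pow_mul, pow_mul, pow_two, pow_two (d ^ 2 ^ n)]
        exact (norm_mul_le _ _).trans (mul_le_mul ih ih (norm_nonneg _) (by positivity))
  obtain ⟨N, hN⟩ := key
  have hpow : DiffContOnCl ℂ (fun w => F w ^ 2 ^ N) U :=
    ⟨hF.differentiableOn.pow _, hF.continuousOn.pow _⟩
  exact srad_le_of_norm_pow_le hd0.le (by positivity)
    (Complex.norm_le_of_forall_mem_frontier_norm_le hU hpow (hN N le_rfl) hz)

theorem srad_le_of_forall_mem_sphere {F : ℂ → B} {w : ℂ} {r : ℝ} (hr : 0 < r)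
    (hF : DifferentiableOn ℂ F (closedBall w r)) {c : ℝ} (hc : 0 ≤ c)
    (h : ∀ z ∈ sphere w r, srad (F z) ≤ c) : srad (F w) ≤ c := by
  refine srad_le_of_forall_mem_frontier (U := ball w r) isBounded_ball ?_ hc ?_
    (subset_closure (mem_ball_self hr))
  · exact DifferentiableOn.diffContOnCl (by rwa [closure_ball w hr.ne'])
  · rwa [frontier_ball w hr.ne']

/-- Liouville's theorem for the spectral radius of an entire function. -/
theorem srad_le_of_bounded {F : ℂ → B} (hF : Differentiable ℂ F) {C : ℝ}
    (hC : ∀ z, srad (F z) ≤ C) (z w : ℂ) : srad (F z) ≤ srad (F w) := by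
  refine le_of_forall_gt_imp_ge_of_dense fun c hc => ?_
  have hc0 : 0 < c := (srad_nonneg _).trans_lt hc
  have hC0 : 0 ≤ C := (srad_nonneg _).trans (hC z)
  have hnhds : ∀ᶠ v in 𝓝 w, srad (F v) ≤ c := by
    simpa using eventually_srad_le (s := Set.univ) hF.continuous.continuousWithinAt hc
  obtain ⟨δ, hδ, hball⟩ := Metric.nhds_basis_closedBall.eventually_iff.1 hnhds
  rcases le_or_gt (dist z w) δ with hzd | hzd
  · exact hball hzd
  set d := dist z w with hd
  have hd0 : 0 < d := hδ.trans hzd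
  -- The maximum principle is applied to `(v - w)⁻¹ • F v ^ m` on an annulus around `w`. The factor
  -- `(v - w)⁻¹` absorbs the bound `C ^ m` on a large outer circle; its cost `d / δ` does not depend
  -- on `m` and disappears on letting `m` grow.
  have key : ∀ m : ℕ, m ≠ 0 → srad (F z) ^ m ≤ d * (c ^ m / δ) := by
    intro m hm
    obtain ⟨R, hR1, hR2⟩ : ∃ R : ℝ, d < R ∧ C ^ m / R ≤ c ^ m / δ := by
      refine ⟨max (d + 1) (C ^ m * δ / c ^ m), (lt_add_one d).trans_le (le_max_left _ _), ?_⟩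
      have hpos : 0 < max (d + 1) (C ^ m * δ / c ^ m) :=
        (by positivity : 0 < d + 1).trans_le (le_max_left _ _)
      rw [div_le_div_iff₀ hpos hδ, ← div_le_iff₀' (by positivity)]
      exact le_max_right _ _
    have hR0 : 0 < R := hd0.trans hR1
    let U : Set ℂ := ball w R \ closedBall w δ
    have hUopen : IsOpen U := isOpen_ball.sdiff isClosed_closedBall
    have hUcl : closure U ⊆ {v | δ ≤ dist v w ∧ dist v w ≤ R} := by
      refine closure_minimal (fun v hv => ⟨?_, (mem_ball.1 hv.1).le⟩) ?_
      · exact (not_le.1 fun h => hv.2 (mem_closedBall.2 h)).le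
      · exact (isClosed_le continuous_const (continuous_id.dist continuous_const)).inter
          (isClosed_le (continuous_id.dist continuous_const) continuous_const)
    have hne : ∀ v ∈ closure U, v - w ≠ 0 := fun v hv h0 => by
      have := (hUcl hv).1
      rw [dist_eq_norm, h0, norm_zero] at this
      exact absurd this (not_le.2 hδ)
    have hdiff : DifferentiableOn ℂ (fun v => (v - w)⁻¹ • F v ^ m) (closure U) := fun v hv =>
      ((((differentiableAt_id.sub_const w).inv (hne v hv)).smul
        ((hF v).pow m))).differentiableWithinAt
    have hsrad : ∀ v, srad ((v - w)⁻¹ • F v ^ m) = srad (F v) ^ m / dist v w := fun v => by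
      rw [srad_smul, srad_pow _ hm, norm_inv, ← dist_eq_norm, div_eq_inv_mul]
    have h1 := srad_le_of_forall_mem_frontier (U := U) (F := fun v => (v - w)⁻¹ • F v ^ m)
      (c := c ^ m / δ) (isBounded_ball.subset Set.sdiff_subset) hdiff.diffContOnCl (by positivity)
      (fun v hv => by
        rw [hsrad]
        have hvcl := hUcl (frontier_subset_closure hv)
        have hvU : v ∉ U := by
          rw [frontier, hUopen.interior_eq] at hv; exact hv.2
        rcases le_or_gt (dist v w) δ with hle | hgt
        · have heq : dist v w = δ := le_antisymm hle hvcl.1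
          rw [heq]
          gcongr
          · exact srad_nonneg _
          · exact hball (mem_closedBall.2 hle)
        · have heq : dist v w = R := by
            refine le_antisymm hvcl.2 (not_lt.1 fun hlt => hvU ⟨hlt, fun h => ?_⟩)
            exact absurd (mem_closedBall.1 h) (not_le.2 hgt)
          rw [heq]
          refine le_trans ?_ hR2
          gcongr
          · exact srad_nonneg _
          · exact hC v)
      (z := z) (subset_closure ⟨hR1, fun h => absurd (mem_closedBall.1 h) (not_le.2 hzd)⟩)
    rw [hsrad] at h1
    rwa [div_le_iff₀' hd0] at h1
  by_contra! hlt
  have hq : 1 < srad (F z) / c := (one_lt_div hc0).2 hlt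
  obtain ⟨m, hm⟩ := ((tendsto_pow_atTop_atTop_of_one_lt hq).eventually_gt_atTop (d / δ)).and
    (eventually_ne_atTop 0) |>.exists
  have h2 := key m hm.2
  have h3 := hm.1
  rw [div_pow, lt_div_iff₀ (by positivity)] at h3
  have : d / δ * c ^ m = d * (c ^ m / δ) := by ring
  linarith

end SpectralRadius

/-! ### Preservation of square-zero elements. -/

section SquareZero

open Filter Topology Metric

variable {B : Type*} [NormedRing B] [NormedAlgebra ℂ B]

/-- The spectral radius is Hölder continuous of exponent `1 / 2` at `b`, along every complex line
through `b`, and vanishes there. -/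
def IsSpectrallyHolder (b : B) : Prop :=
  ∀ c : B, ∃ K : ℝ, ∀ l : ℂ, ‖l‖ ≤ 1 → srad (b + l • c) ^ 2 ≤ K * ‖l‖

theorem IsSpectrallyBounded.isSpectrallyHolder {A : Type*} [NormedRing A] [NormedAlgebra ℂ A]
    [CompleteSpace A] {T : A →ₗ[ℂ] B} (hT : IsSpectrallyBounded T)
    (hsurj : Function.Surjective T) {a : A} (ha : a * a = 0) : IsSpectrallyHolder (T a) := by
  obtain ⟨M, hM⟩ := hT
  have hM' : ∀ x, srad (T x) ≤ M * srad x := fun x => by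
    have := ENNReal.toReal_mono
      (ENNReal.mul_ne_top ENNReal.coe_ne_top (spectralRadius_ne_top x)) (hM x)
    simpa [srad] using this
  intro c
  obtain ⟨x, rfl⟩ := hsurj c
  refine ⟨M ^ 2 * (‖a * x + x * a‖ + ‖x * x‖), fun l hl => ?_⟩
  rw [← map_smul, ← map_add]
  have h1 : (a + l • x) ^ 2 = l • ((a * x + x * a) + l • (x * x)) := by
    simp only [pow_two, mul_add, add_mul, mul_smul_comm, smul_mul_assoc, ha, smul_add]
    abel
  have h2 : srad (a + l • x) ^ 2 ≤ ‖l‖ * (‖a * x + x * a‖ + ‖x * x‖) := by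
    rw [← srad_pow _ two_ne_zero, h1, srad_smul]
    gcongr
    refine (srad_le_norm _).trans ((norm_add_le _ _).trans ?_)
    gcongr
    rw [norm_smul]
    exact mul_le_of_le_one_left (norm_nonneg _) hl
  calc srad (T (a + l • x)) ^ 2 ≤ (M * srad (a + l • x)) ^ 2 :=
        pow_le_pow_left₀ (srad_nonneg _) (hM' _) 2
    _ = M ^ 2 * srad (a + l • x) ^ 2 := by ring
    _ ≤ M ^ 2 * (‖l‖ * (‖a * x + x * a‖ + ‖x * x‖)) := by gcongr
    _ = _ := by ring

theorem IsSpectrallyHolder.srad_eq_zero {b : B} (hb : IsSpectrallyHolder b) : srad b = 0 := by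
  obtain ⟨K, hK⟩ := hb 0
  have := hK 0 (by simp)
  simp only [smul_zero, add_zero, norm_zero, mul_zero] at this
  exact pow_eq_zero_iff two_ne_zero |>.1 (le_antisymm this (sq_nonneg _))

variable [CompleteSpace B] {b : B}

/-- The entire function `exp (-w) b + exp w b'`, with `b'` the conjugate of `b`, has bounded
spectral radius: the Hölder bound at `b` handles `Re w ≤ 0`, and conjugating back by `u` handles `Re
w ≥ 0`. By Liouville its spectral radius is constant, and it is evaluated where `exp (2 w) = l` and
where `exp (2 w) = -1`. -/
theorem IsSpectrallyHolder.srad_add_smul_conj_sq_le (hb : IsSpectrallyHolder b) (u : Bˣ) {l : ℂ}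
    (hl : l ≠ 0) :
    srad (b + l • (↑u⁻¹ * b * u)) ^ 2 ≤ ‖l‖ * srad (b - ↑u⁻¹ * b * u) ^ 2 := by
  set b' : B := ↑u⁻¹ * b * u with hb'
  obtain ⟨K₁, hK₁⟩ := hb b'
  obtain ⟨K₂, hK₂⟩ := hb (u * b * ↑u⁻¹)
  let F : ℂ → B := fun w => Complex.exp (-w) • b + Complex.exp w • b'
  have hF : Differentiable ℂ F :=
    ((Complex.differentiable_exp.comp differentiable_neg).smul_const b).add
      (Complex.differentiable_exp.smul_const b')
  have h2 : ∀ w, Complex.exp (2 * w) = Complex.exp w * Complex.exp w := fun w => by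
    rw [← Complex.exp_add, two_mul]
  have hF1 : ∀ w, F w = Complex.exp (-w) • (b + Complex.exp (2 * w) • b') := fun w => by
    simp only [F]
    rw [smul_add, smul_smul, h2, ← mul_assoc, ← Complex.exp_add, neg_add_cancel, Complex.exp_zero,
      one_mul]
  have hF2 : ∀ w, F w = Complex.exp w •
      (↑u⁻¹ * (b + Complex.exp (2 * -w) • (u * b * ↑u⁻¹)) * u) := fun w => by
    have h3 : ↑u⁻¹ * (b + Complex.exp (2 * -w) • (u * b * ↑u⁻¹)) * u
        = b' + Complex.exp (2 * -w) • b := by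
      simp only [mul_add, add_mul, mul_smul_comm, smul_mul_assoc, hb']
      congr 2
      simp [mul_assoc]
    rw [h3, smul_add, smul_smul, h2, ← mul_assoc, ← Complex.exp_add, add_neg_cancel,
      Complex.exp_zero, one_mul, add_comm]
  have hbound : ∀ w, srad (F w) ^ 2 ≤ max K₁ K₂ := fun w => by
    rcases le_total ‖Complex.exp w‖ 1 with hw | hw
    · have h4 := hK₁ (Complex.exp (2 * w)) (by
        rw [h2, norm_mul]; exact mul_le_one₀ hw (norm_nonneg _) hw)
      rw [hF1, srad_smul, mul_pow]
      refine le_trans (mul_le_mul_of_nonneg_left h4 (sq_nonneg _)) (le_trans (le_of_eq ?_)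
        (le_max_left _ _))
      rw [h2, norm_mul, Complex.exp_neg, norm_inv]
      have : ‖Complex.exp w‖ ≠ 0 := norm_ne_zero_iff.2 (Complex.exp_ne_zero w)
      field_simp
    · have h4 := hK₂ (Complex.exp (2 * -w)) (by
        rw [h2, norm_mul, Complex.exp_neg, norm_inv]
        exact mul_le_one₀ (inv_le_one_of_one_le₀ hw) (by positivity) (inv_le_one_of_one_le₀ hw))
      rw [hF2, srad_smul, srad_conj, mul_pow]
      refine le_trans (mul_le_mul_of_nonneg_left h4 (sq_nonneg _)) (le_trans (le_of_eq ?_)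
        (le_max_right _ _))
      rw [h2, norm_mul, Complex.exp_neg, norm_inv]
      have : ‖Complex.exp w‖ ≠ 0 := norm_ne_zero_iff.2 (Complex.exp_ne_zero w)
      field_simp
  have hLiou := srad_le_of_bounded hF (C := Real.sqrt (max K₁ K₂))
    (fun w => Real.le_sqrt_of_sq_le (hbound w))
  have hsub : srad (F (Real.pi / 2 * Complex.I)) = srad (b - b') := by
    have : F (Real.pi / 2 * Complex.I) = (-Complex.I) • (b - b') := by
      simp only [F]
      rw [Complex.exp_neg, Complex.exp_pi_div_two_mul_I, Complex.inv_I, smul_sub, neg_smul,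
        neg_smul]
      abel
    rw [this, srad_smul]; simp
  set w : ℂ := Complex.log l / 2 with hw
  have hexp : Complex.exp (2 * w) = l := by
    rw [hw, mul_div_cancel₀ _ two_ne_zero, Complex.exp_log hl]
  have h5 : b + l • b' = Complex.exp w • F w := by
    rw [hF1, smul_smul, ← Complex.exp_add, add_neg_cancel, Complex.exp_zero, one_smul, hexp]
  have h6 : ‖l‖ = ‖Complex.exp w‖ ^ 2 := by rw [← hexp, h2, norm_mul, pow_two]
  rw [h5, srad_smul, mul_pow, h6]
  gcongr
  · exact srad_nonneg _
  · exact (hLiou w (Real.pi / 2 * Complex.I)).trans hsub.le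

/-- Conjugation by `u = 1 + t y` gives `b + t G(t)`, where `G(0)` is the commutator. Taking `l = k t
- 1` in the previous estimate makes both sides homogeneous in `t`; after cancelling, the bound on a
small circle is independent of `k`, and the maximum principle carries it to `t = 0`. -/
theorem IsSpectrallyHolder.exists_srad_smul_add_le (hb : IsSpectrallyHolder b) (y : B) :
    ∃ C : ℝ, ∀ k : ℂ, srad (k • b - (b * y - y * b)) ≤ C := by
  set q := b * y - y * b with hq
  let G : ℂ → B := fun t => Ring.inverse (1 + t • y) * q
  obtain ⟨δ, hδ, hunit⟩ : ∃ δ > 0, ∀ t : ℂ, ‖t‖ ≤ δ → IsUnit (1 + t • y) := by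
    refine ⟨(‖y‖ + 1)⁻¹, by positivity, fun t ht => ?_⟩
    have : ‖-(t • y)‖ < 1 := by
      rw [norm_neg, norm_smul]
      calc ‖t‖ * ‖y‖ ≤ (‖y‖ + 1)⁻¹ * ‖y‖ := by gcongr
        _ < 1 := by rw [inv_mul_lt_iff₀ (by positivity)]; linarith
    simpa using isUnit_one_sub_of_norm_lt_one this
  have hGd : DifferentiableOn ℂ G (closedBall 0 δ) := fun t ht => by
    have ht' : ‖t‖ ≤ δ := by simpa using ht
    refine DifferentiableAt.differentiableWithinAt (DifferentiableAt.mul_const ?_ q)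
    exact (differentiableAt_inverse (𝕜 := ℂ) (hunit t ht')).comp t
      ((differentiableAt_id.smul_const y).const_add 1)
  obtain ⟨C, hC⟩ := (isCompact_closedBall (0 : ℂ) δ).exists_bound_of_continuousOn hGd.continuousOn
  have hC0 : 0 ≤ C := (norm_nonneg _).trans (hC 0 (mem_closedBall_self hδ.le))
  refine ⟨2 * C, fun k => ?_⟩
  let H : ℂ → B := fun t => k • b + (k * t - 1) • G t
  have hH0 : H 0 = k • b - q := by simp [H, G, sub_eq_add_neg]
  rw [← hH0]
  -- The radius may depend on `k`; it ensures `|k t| < 1`, hence `l ≠ 0` and `|l| ≤ 2`.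
  set r : ℝ := min δ (‖k‖ + 1)⁻¹ with hr
  have hr0 : 0 < r := lt_min hδ (by positivity)
  have hkr : ∀ t : ℂ, ‖t‖ ≤ r → ‖k * t‖ < 1 := fun t ht => by
    rw [norm_mul]
    calc ‖k‖ * ‖t‖ ≤ ‖k‖ * (‖k‖ + 1)⁻¹ := by gcongr; exact ht.trans (min_le_right _ _)
      _ < 1 := by rw [mul_inv_lt_iff₀ (by positivity)]; linarith
  refine srad_le_of_forall_mem_sphere hr0 ?_ (by positivity) fun t ht => ?_
  · have h1 := hGd.mono (closedBall_subset_closedBall (min_le_left δ (‖k‖ + 1)⁻¹))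
    exact DifferentiableOn.const_add (k • b) (DifferentiableOn.smul
      (((differentiable_id.const_mul k).sub_const 1).differentiableOn) h1)
  · have htr : ‖t‖ = r := by simpa using ht
    have ht0 : t ≠ 0 := norm_pos_iff.1 (htr ▸ hr0)
    have htδ : ‖t‖ ≤ δ := htr.le.trans (min_le_left _ _)
    set u : Bˣ := (hunit t htδ).unit with hu
    have hu1 : (u : B) = 1 + t • y := IsUnit.unit_spec _
    have hconj : ↑u⁻¹ * b * u = b + t • G t := by
      have : Ring.inverse (1 + t • y) = ((u⁻¹ : Bˣ) : B) := by rw [← hu1, Ring.inverse_unit]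
      simp only [G, this]
      rw [← mul_smul_comm, mul_assoc, ← Units.inv_mul_cancel_left u b, ← mul_add]
      simp only [Units.inv_mul_cancel_left]
      congr 1
      rw [hu1, hq, smul_sub]
      simp only [mul_add, add_mul, mul_one, one_mul, mul_smul_comm, smul_mul_assoc]
      abel
    have hl : k * t - 1 ≠ 0 := fun h => by
      have := hkr t htr.le
      rw [sub_eq_zero.1 h, norm_one] at this
      exact lt_irrefl _ this
    have h1 := hb.srad_add_smul_conj_sq_le u hl
    rw [hconj] at h1
    have h2 : b + (k * t - 1) • (b + t • G t) = t • H t := by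
      simp only [H, smul_add, smul_smul, sub_smul, sub_mul, one_smul, one_mul]
      module
    have h3 : b - (b + t • G t) = (-t) • G t := by module
    rw [h2, h3, srad_smul, srad_smul, norm_neg, mul_pow, mul_pow] at h1
    have h4 : srad (G t) ≤ C := (srad_le_norm _).trans (hC t (by simpa using htδ))
    have h5 : ‖k * t - 1‖ ≤ 2 := (norm_sub_le _ _).trans (by
      rw [norm_one]; linarith [hkr t htr.le])
    have h6 : 0 < ‖t‖ ^ 2 := by positivity
    have h7 : srad (H t) ^ 2 ≤ 2 * C ^ 2 := by
      have h8 : srad (G t) ^ 2 ≤ C ^ 2 := pow_le_pow_left₀ (srad_nonneg _) h4 2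
      have h9 : ‖t‖ ^ 2 * srad (H t) ^ 2 ≤ ‖t‖ ^ 2 * (2 * C ^ 2) := by
        calc _ ≤ _ := h1
          _ ≤ 2 * (‖t‖ ^ 2 * C ^ 2) := by gcongr
          _ = _ := by ring
      exact le_of_mul_le_mul_left h9 h6
    refine abs_le_of_sq_le_sq' ?_ (by positivity) |>.2
    nlinarith [sq_nonneg C]

theorem IsSpectrallyHolder.srad_smul_add_commutator_le (hb : IsSpectrallyHolder b) (y : B)
    (k : ℂ) : srad (k • b + (b * y - y * b)) ≤ srad (b * y - y * b) := by
  obtain ⟨C, hC⟩ := hb.exists_srad_smul_add_le y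
  have h := srad_le_of_bounded (F := fun k : ℂ => k • b - (b * y - y * b))
    ((differentiable_id.smul_const b).sub_const _) hC (-k) 0
  have h1 : (-k) • b - (b * y - y * b) = -(k • b + (b * y - y * b)) := by module
  simp only [zero_smul, zero_sub] at h
  rwa [h1, srad_neg, srad_neg] at h

theorem isUnit_one_sub_smul_of_srad_eq_zero (h : srad b = 0) (k : ℂ) : IsUnit (1 - k • b) := by
  have := isUnit_of_srad_lt (x := k • b) (k := 1) (by rw [srad_smul, h]; simp)
  simpa using this

/-- Factoring out `(1 - k b)⁻¹` from `m - (1 - k b)⁻¹ q` leaves `m - (m k b + q)`, which is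
invertible for `|m| > r(q)`. -/
theorem IsSpectrallyHolder.srad_inverse_mul_commutator_le (hb : IsSpectrallyHolder b) (y : B)
    (k : ℂ) : srad (Ring.inverse (1 - k • b) * (b * y - y * b)) ≤ srad (b * y - y * b) := by
  refine srad_le_of_isUnit (srad_nonneg _) fun m hm => ?_
  have hk := isUnit_one_sub_smul_of_srad_eq_zero hb.srad_eq_zero k
  have h1 : IsUnit (algebraMap ℂ B m - ((m * k) • b + (b * y - y * b))) :=
    isUnit_of_srad_lt ((hb.srad_smul_add_commutator_le y _).trans_lt hm)
  have h2 : algebraMap ℂ B m - Ring.inverse (1 - k • b) * (b * y - y * b)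
      = Ring.inverse (1 - k • b) * (algebraMap ℂ B m - ((m * k) • b + (b * y - y * b))) := by
    have h3 : algebraMap ℂ B m - ((m * k) • b + (b * y - y * b))
        = (1 - k • b) * algebraMap ℂ B m - (b * y - y * b) := by
      simp only [Algebra.algebraMap_eq_smul_one, mul_smul_comm, mul_one]
      module
    rw [h3, mul_sub (Ring.inverse _) ((1 - k • b) * _), Ring.inverse_mul_cancel_left _ _ hk]
  rw [h2]
  exact (isUnit_ringInverse.2 hk).mul h1

theorem IsSpectrallyHolder.srad_commutator_mul_self (hb : IsSpectrallyHolder b) (y : B) :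
    srad ((b * y - y * b) * b) = 0 := by
  have hunit := isUnit_one_sub_smul_of_srad_eq_zero hb.srad_eq_zero
  set q := b * y - y * b with hq
  -- `q (1 - k b)` is again a commutator with `b`, so `l ↦ (1 - l b)⁻¹ q (1 - k b)` has bounded,
  -- hence constant, spectral radius; at `l = k` it is similar to `q`.
  have hqk : ∀ k : ℂ, srad (q * (1 - k • b)) ≤ srad q := fun k => by
    have h1 : q * (1 - k • b) = b * (y * (1 - k • b)) - (y * (1 - k • b)) * b := by
      simp only [hq, mul_sub, sub_mul, mul_one, mul_smul_comm, smul_mul_assoc, mul_assoc]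
      module
    have h2 : srad (q * (1 - k • b)) ≤ srad (Ring.inverse (1 - k • b) * (q * (1 - k • b))) := by
      have hF : Differentiable ℂ fun l : ℂ => Ring.inverse (1 - l • b) * (q * (1 - k • b)) :=
        fun l => ((differentiableAt_inverse (𝕜 := ℂ) (hunit l)).comp l
          ((differentiableAt_id.smul_const b).const_sub 1)).mul_const _
      have := srad_le_of_bounded hF (C := srad (q * (1 - k • b))) (fun l => by
        rw [h1]; exact hb.srad_inverse_mul_commutator_le _ l) 0 k
      simpa using this
    refine h2.trans (le_of_eq ?_)
    rw [srad_comm, mul_assoc, Ring.mul_inverse_cancel _ (hunit k), mul_one]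
  refine le_antisymm (le_of_forall_pos_le_add fun ε hε => ?_) (srad_nonneg _)
  set r := ε / (srad q + 1) with hr
  have hq0 := srad_nonneg q
  have hr0 : 0 < r := by positivity
  -- On a small circle `t q - q b = t q (1 - t⁻¹ b)` has spectral radius at most `|t| r(q)`; the
  -- centre gives `r(q b) ≤ ε`.
  have h := srad_le_of_forall_mem_sphere (F := fun t : ℂ => t • q - q * b) (w := 0) hr0
    ((differentiable_id.smul_const q).sub_const _).differentiableOn hε.le (fun t ht => by
      have htr : ‖t‖ = r := by simpa using ht
      have ht0 : t ≠ 0 := norm_pos_iff.1 (htr ▸ hr0)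
      have h3 : t • q - q * b = t • (q * (1 - t⁻¹ • b)) := by
        rw [mul_sub, mul_one, smul_sub t q, mul_smul_comm, smul_smul, mul_inv_cancel₀ ht0, one_smul]
      rw [h3, srad_smul, htr]
      calc r * srad (q * (1 - t⁻¹ • b)) ≤ r * srad q := by gcongr; exact hqk _
        _ ≤ r * (srad q + 1) := by gcongr; linarith
        _ = ε := by rw [hr]; field_simp)
  simpa [srad_neg] using h

theorem smul_smul_eq_zero_of_srad_commutator_mul_self {E : Type*} [AddCommGroup E] [Module B E]
    [IsSimpleModule B E] (hb : srad b = 0) (hbq : ∀ y, srad ((b * y - y * b) * b) = 0) (w : E) :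
    b • b • w = 0 := by
  by_contra hne
  by_cases h : ∃ x : B, x • b • w = 0 ∧ x • b • b • w ≠ 0
  · obtain ⟨x, hx, hx'⟩ := h
    -- With `y = g x`, the element `(b y - y b) b` sends `w` to `-w`, contradicting quasinilpotence.
    obtain ⟨g, hg⟩ := IsSimpleModule.toSpanSingleton_surjective B hx' w
    rw [LinearMap.toSpanSingleton_apply] at hg
    have hu : IsUnit (1 - (-1 : ℂ) • ((b * (g * x) - g * x * b) * b)) :=
      isUnit_one_sub_smul_of_srad_eq_zero (hbq (g * x)) (-1)
    have h0 : (1 - (-1 : ℂ) • ((b * (g * x) - g * x * b) * b)) • w = 0 := by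
      rw [neg_one_smul, sub_neg_eq_add]
      simp only [add_smul, sub_smul, mul_smul, one_smul, hx, hg, smul_zero]
      abel
    rw [hu.smul_eq_zero] at h0
    exact hne (by simp [h0])
  · push Not at h
    -- Now the annihilator of `b w` is stable under right multiplication by `b`. Hence `g b` fixes
    -- every `b ^ n b w`, so `g ^ n b ^ n` fixes `b w`, which is impossible once `‖g ^ n b ^ n‖ <
    -- 1`.
    obtain ⟨g, hg⟩ := IsSimpleModule.toSpanSingleton_surjective B hne (b • w)
    rw [LinearMap.toSpanSingleton_apply] at hg
    have h1 : ∀ n : ℕ, ∀ x : B, x • b • w = 0 → x • b ^ n • b • w = 0 := by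
      intro n
      induction n with
      | zero => intro x hx; simpa using hx
      | succ n ih =>
        intro x hx
        have := ih (x * b) (by simpa [mul_smul] using h x hx)
        rwa [mul_smul, ← mul_smul b, ← pow_succ'] at this
    have h2 : ∀ n : ℕ, g ^ n • b ^ n • b • w = b • w := by
      intro n
      induction n with
      | zero => simp
      | succ n ih =>
        have h3 := h1 n (g * b - 1) (by simp [sub_smul, mul_smul, hg])
        rw [sub_smul, one_smul, sub_eq_zero, mul_smul, ← mul_smul b, ← pow_succ'] at h3
        rw [pow_succ g, mul_smul, h3, ih]
    have hlt : srad b < (‖g‖ + 1)⁻¹ := by rw [hb]; positivity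
    obtain ⟨n, hn, hn0⟩ := ((eventually_norm_pow_lt hlt).and (eventually_ne_atTop 0)).exists
    have h4 : ‖g ^ n * b ^ n‖ < 1 := by
      have hg0 := norm_nonneg g
      calc ‖g ^ n * b ^ n‖ ≤ ‖g‖ ^ n * ‖b ^ n‖ :=
            (norm_mul_le _ _).trans (by gcongr; exact norm_pow_le' g (Nat.pos_of_ne_zero hn0))
        _ ≤ (‖g‖ + 1) ^ n * ‖b ^ n‖ := by gcongr; linarith
        _ < (‖g‖ + 1) ^ n * (‖g‖ + 1)⁻¹ ^ n := by gcongr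
        _ = 1 := by rw [← mul_pow, mul_inv_cancel₀ (by positivity), one_pow]
    have h5 := isUnit_one_sub_of_norm_lt_one h4
    have h6 : (1 - g ^ n * b ^ n) • b • w = 0 := by
      rw [sub_smul, one_smul, mul_smul, h2, sub_self]
    rw [h5.smul_eq_zero] at h6
    exact hne (by simp [h6])

theorem IsSpectrallyHolder.mul_self_mem_jacobson (hb : IsSpectrallyHolder b) :
    b * b ∈ Ring.jacobson B := by
  refine Submodule.mem_sInf.2 fun I hI => ?_
  have : IsSimpleModule B (B ⧸ I) := isSimpleModule_iff_isCoatom.2 hI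
  have h := smul_smul_eq_zero_of_srad_commutator_mul_self hb.srad_eq_zero
    hb.srad_commutator_mul_self (Submodule.Quotient.mk (p := I) (1 : B))
  rw [← Submodule.Quotient.mk_smul, ← Submodule.Quotient.mk_smul,
    Submodule.Quotient.mk_eq_zero] at h
  simpa using h

/-- A spectrally bounded linear map onto a semisimple Banach algebra preserves elements of square
zero. -/
theorem IsSpectrallyBounded.map_mul_self_eq_zero {A : Type*} [NormedRing A] [NormedAlgebra ℂ A]
    [CompleteSpace A] (hB : Ring.jacobson B = ⊥) {T : A →ₗ[ℂ] B} (hT : IsSpectrallyBounded T)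
    (hsurj : Function.Surjective T) {a : A} (ha : a * a = 0) : T a * T a = 0 := by
  have h := (hT.isSpectrallyHolder hsurj ha).mul_self_mem_jacobson
  rwa [hB, Submodule.mem_bot] at h

end SquareZero

/-! ### Square-zero elements span properly infinite corners. -/

section ProperlyInfinite

variable {A : Type*}

/-- The linear span of the elements of square zero in the corner of `p`. -/
def squareZeroSpan [Ring A] [Algebra ℂ A] (p : A) : Submodule ℂ A :=
  Submodule.span ℂ {x | p * x = x ∧ x * p = x ∧ x * x = 0}

section Algebra

variable [Ring A] [Algebra ℂ A] {p : A}

theorem mem_squareZeroSpan {x : A} (h1 : p * x = x) (h2 : x * p = x) (h : x * x = 0) :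
    x ∈ squareZeroSpan p :=
  Submodule.subset_span ⟨h1, h2, h⟩

/-- `(1 + g) x (1 - h)` has square zero because `x (1 - h) (1 + g) x = 0`; its cross terms `x h` and
`g x` have square zero as well. -/
theorem sub_conj_mem_squareZeroSpan {g h x : A} (hpg : p * g = g) (hhp : h * p = h)
    (hpx : p * x = x) (hxp : x * p = x) (hxg : x * g = 0) (hhx : h * x = 0)
    (hxx : x * h * g * x = x * x) : x - g * x * h ∈ squareZeroSpan p := by
  have hX : x - x * h + g * x - g * x * h ∈ squareZeroSpan p := by
    refine mem_squareZeroSpan ?_ ?_ ?_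
    · simp only [mul_add, mul_sub, ← mul_assoc, hpx, hpg]
    · simp only [add_mul, sub_mul, mul_assoc, hxp, hhp]
    · have : (x - x * h + g * x - g * x * h) * (x - x * h + g * x - g * x * h)
          = (1 + g) * (x * x + (x * g) * x - x * (h * x) - x * h * g * x) * (1 - h) := by
        noncomm_ring
      rw [this, hxg, hhx, hxx]
      simp
  have h1 : x * h ∈ squareZeroSpan p := by
    refine mem_squareZeroSpan (by rw [← mul_assoc, hpx]) (by rw [mul_assoc, hhp]) ?_
    rw [mul_assoc, ← mul_assoc h, hhx, zero_mul, mul_zero]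
  have h2 : g * x ∈ squareZeroSpan p := by
    refine mem_squareZeroSpan (by rw [← mul_assoc, hpg]) (by rw [mul_assoc, hxp]) ?_
    rw [mul_assoc, ← mul_assoc x, hxg, zero_mul, mul_zero]
  have : x - g * x * h = (x - x * h + g * x - g * x * h) + x * h - g * x := by abel
  rw [this]
  exact Submodule.sub_mem _ (Submodule.add_mem _ hX h1) h2

end Algebra

variable [CStarAlgebra A] {p : A}

/-- An isometry of the unital algebra `p A p`. -/
structure IsCornerIsometry (p s : A) : Prop where
  star_mul : star s * s = p
  left : p * s = s
  right : s * p = s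

namespace IsCornerIsometry

variable {s t : A}

theorem star_left (hp : IsStarProjection p) (hs : IsCornerIsometry p s) :
    p * star s = star s := by
  have := congrArg star hs.right
  rwa [StarMul.star_mul, hp.isSelfAdjoint.star_eq] at this

theorem star_right (hp : IsStarProjection p) (hs : IsCornerIsometry p s) :
    star s * p = star s := by
  have := congrArg star hs.left
  rwa [StarMul.star_mul, hp.isSelfAdjoint.star_eq] at this

theorem mul (hs : IsCornerIsometry p s) (ht : IsCornerIsometry p t) :
    IsCornerIsometry p (s * t) where
  star_mul := by
    rw [StarMul.star_mul, mul_assoc, ← mul_assoc (star s), hs.star_mul, ht.left, ht.star_mul]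
  left := by rw [← mul_assoc, hs.left]
  right := by rw [mul_assoc, ht.right]

theorem star_mul_mul_eq_zero (hst : star s * t = 0) (r : A) : star s * (t * r) = 0 := by
  rw [← mul_assoc, hst, zero_mul]

/-- Conjugation by two isometries with orthogonal ranges is a contraction. -/
theorem norm_conj_add_conj_le (hp : IsStarProjection p) (hs : IsCornerIsometry p s)
    (ht : IsCornerIsometry p t) (hst : star s * t = 0) :
    ‖ContinuousLinearMap.mulLeftRight ℂ A s (star s) +
      ContinuousLinearMap.mulLeftRight ℂ A t (star t)‖ ≤ 1 := by
  set Φ := ContinuousLinearMap.mulLeftRight ℂ A s (star s) +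
    ContinuousLinearMap.mulLeftRight ℂ A t (star t) with hΦ
  have hΦx : ∀ x, Φ x = s * x * star s + t * x * star t := fun x => rfl
  have hts : star t * s = 0 := by simpa using congrArg star hst
  have hp1 : ‖p‖ ≤ 1 := by
    have h1 : ‖p‖ * ‖p‖ = ‖p‖ := by
      rw [← CStarRing.norm_star_mul_self, hp.isSelfAdjoint.star_eq, hp.isIdempotentElem.eq]
    by_contra! h
    nlinarith
  -- This C⋆-identity gives `‖Φ‖ ^ 2 ≤ ‖Φ‖`.
  have hmul : ∀ x, star (Φ x) * Φ x = Φ (star (p * x) * (p * x)) := fun x => by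
    have e1 : star (Φ x) * Φ x = s * star x * (star s * s) * x * star s
        + s * star x * (star s * t) * x * star t + t * star x * (star t * s) * x * star s
        + t * star x * (star t * t) * x * star t := by
      simp only [hΦx, star_add, StarMul.star_mul, star_star]
      noncomm_ring
    have e2 : star (p * x) * (p * x) = star x * p * x := by
      rw [StarMul.star_mul, hp.isSelfAdjoint.star_eq, mul_assoc, ← mul_assoc p,
        hp.isIdempotentElem.eq, mul_assoc]
    rw [e1, e2, hst, hts, hs.star_mul, ht.star_mul, hΦx]
    noncomm_ring
  have hbound : ∀ x, ‖Φ x‖ ≤ Real.sqrt ‖Φ‖ * ‖x‖ := fun x => by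
    refine abs_le_of_sq_le_sq' ?_ (by positivity) |>.2
    rw [mul_pow, Real.sq_sqrt (norm_nonneg _), pow_two, ← CStarRing.norm_star_mul_self, hmul]
    refine (Φ.le_opNorm _).trans ?_
    rw [CStarRing.norm_star_mul_self, ← pow_two]
    gcongr
    calc ‖p * x‖ ≤ ‖p‖ * ‖x‖ := norm_mul_le _ _
      _ ≤ 1 * ‖x‖ := by gcongr
      _ = ‖x‖ := one_mul _
  have h := Φ.opNorm_le_bound (Real.sqrt_nonneg _) hbound
  by_contra! h1
  have h2 := Real.sq_sqrt (norm_nonneg Φ)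
  nlinarith [Real.sqrt_nonneg ‖Φ‖]

theorem exists_eq_add_half_conj (hp : IsStarProjection p) (hs : IsCornerIsometry p s)
    (ht : IsCornerIsometry p t) (hst : star s * t = 0) {w : A} (hw : p * w = w) (hw' : w * p = w) :
    ∃ z : A, p * z = z ∧ z * p = z ∧
      z = w + (1 / 2 : ℂ) • (s * z * star s + t * z * star t) := by
  set Φ := ContinuousLinearMap.mulLeftRight ℂ A s (star s) +
    ContinuousLinearMap.mulLeftRight ℂ A t (star t) with hΦ
  have h1 : ‖(1 / 2 : ℂ) • Φ‖ < 1 := by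
    rw [norm_smul]
    have := norm_conj_add_conj_le hp hs ht hst
    norm_num
    linarith
  have hu := isUnit_one_sub_of_norm_lt_one h1
  set z := (Ring.inverse (1 - (1 / 2 : ℂ) • Φ)) w with hz
  have hzeq : z = w + (1 / 2 : ℂ) • (s * z * star s + t * z * star t) := by
    have h2 : (1 - (1 / 2 : ℂ) • Φ) z = w := by
      rw [hz, ← mul_apply_eq_comp, Ring.mul_inverse_cancel _ hu]
      rfl
    rw [← sub_eq_iff_eq_add]
    exact h2
  refine ⟨z, ?_, ?_, hzeq⟩
  · rw [hzeq]
    simp only [mul_add, mul_smul_comm, ← mul_assoc, hw, hs.left, ht.left]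
  · rw [hzeq]
    simp only [add_mul, smul_mul_assoc, mul_assoc, hw', hs.star_right hp, ht.star_right hp]

/-- The partial isometry `t s⋆` carries the first conjugate to the second, so
`sub_conj_mem_squareZeroSpan` applies with it and its adjoint. -/
theorem conj_sub_conj_mem (hp : IsStarProjection p) (hs : IsCornerIsometry p s)
    (ht : IsCornerIsometry p t) (hst : star s * t = 0) {z : A} (hz : p * z = z) (hz' : z * p = z) :
    s * z * star s - t * z * star t ∈ squareZeroSpan p := by
  have hts : star t * s = 0 := by simpa using congrArg star hst
  have h := sub_conj_mem_squareZeroSpan (p := p) (g := t * star s) (h := s * star t)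
    (x := s * z * star s) (by rw [← mul_assoc, ht.left]) (by rw [mul_assoc, ht.star_right hp])
    (by simp only [← mul_assoc, hs.left]) (by rw [mul_assoc, hs.star_right hp])
    (by rw [mul_assoc, ← mul_assoc (star s), hst, zero_mul, mul_zero])
    (by simp only [mul_assoc]; rw [← mul_assoc (star t), hts, zero_mul, mul_zero])
    (by
      calc s * z * star s * (s * star t) * (t * star s) * (s * z * star s)
          = s * z * (star s * s) * (star t * t) * star s * (s * z * star s) := by noncomm_ring
        _ = s * (z * p) * p * star s * (s * z * star s) := by
            rw [hs.star_mul, ht.star_mul]; noncomm_ring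
        _ = _ := by rw [hz', mul_assoc s, hz'])
  convert h using 2
  calc t * z * star t = t * (p * z * p) * star t := by rw [hz, hz']
    _ = t * ((star s * s) * z * (star s * s)) * star t := by rw [hs.star_mul]
    _ = _ := by noncomm_ring

/-- If the corner of `p` contains two isometries with orthogonal ranges, then it is spanned by
elements of square zero. -/
theorem corner_mem_squareZeroSpan {u v : A} (hp : IsStarProjection p) (hu : IsCornerIsometry p u)
    (hv : IsCornerIsometry p v) (huv : star u * v = 0) {y : A} (hy : p * y = y) (hy' : y * p = y) :
    y ∈ squareZeroSpan p := by
  have hvu : star v * u = 0 := by simpa using congrArg star huv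
  have conj_mem : ∀ {y : A}, p * y = y → y * p = y → v * y * star v ∈ squareZeroSpan p := by
    intro y hy hy'
    have hs := hv.mul hu
    have ht := hv.mul hv
    have hst : star (v * u) * (v * v) = 0 := by
      rw [StarMul.star_mul, mul_assoc, ← mul_assoc (star v), hv.star_mul, hv.left, huv]
    -- Conjugating this equation by `u` and working modulo the span, both `z`-terms on the right
    -- become `v z v⋆`, with total weight one, as does the left side. They cancel, leaving `u u y (u
    -- u)⋆`, which is congruent to `v y v⋆`.
    obtain ⟨z, hz, hz', hzeq⟩ := exists_eq_add_half_conj hp hs ht hst (w := u * y * star u)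
      (by simp only [← mul_assoc, hu.left]) (by rw [mul_assoc, hu.star_right hp])
    have h1 := conj_sub_conj_mem hp hu hv huv hz hz'
    have h2 := conj_sub_conj_mem hp hv (hu.mul hs) (star_mul_mul_eq_zero hvu _) hz hz'
    have h3 := conj_sub_conj_mem hp hv (hu.mul ht) (star_mul_mul_eq_zero hvu _) hz hz'
    have h4 := conj_sub_conj_mem hp hv (hu.mul hu) (star_mul_mul_eq_zero hvu _) hy hy'
    have h5 : u * z * star u = u * u * y * star (u * u)
        + (1 / 2 : ℂ) • (u * (v * u) * z * star (u * (v * u))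
          + u * (v * v) * z * star (u * (v * v))) := by
      conv_lhs => rw [hzeq]
      simp only [mul_add, add_mul, mul_smul_comm, smul_mul_assoc, StarMul.star_mul, mul_assoc]
    have h6 : v * y * star v = (v * y * star v - u * u * y * star (u * u))
        + (u * z * star u - v * z * star v)
        + (1 / 2 : ℂ) • ((v * z * star v - u * (v * u) * z * star (u * (v * u)))
          + (v * z * star v - u * (v * v) * z * star (u * (v * v)))) := by
      rw [h5]
      module
    rw [h6]
    exact Submodule.add_mem _ (Submodule.add_mem _ h4 h1)
      (Submodule.smul_mem _ _ (Submodule.add_mem _ h2 h3))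
  -- Peirce decomposition along `e` and `p - e`: the off-diagonal blocks have square zero, the `e`
  -- block is a conjugate by `v`, and the last block `x` is congruent to `v x v⋆`.
  set e := v * star v with he
  have hpe : p * e = e := by rw [he, ← mul_assoc, hv.left]
  have hep : e * p = e := by rw [he, mul_assoc, hv.star_right hp]
  have hev : e * v = v := by rw [he, mul_assoc, hv.star_mul, hv.right]
  have hve : star v * e = star v := by rw [he, ← mul_assoc, hv.star_mul, hv.star_left hp]
  have hee : e * e = e := by nth_rw 1 [he]; rw [mul_assoc, hve]
  have hpp : p * p = p := hp.isIdempotentElem.eq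
  have h1 : e * y * e ∈ squareZeroSpan p := by
    have h := conj_mem (y := star v * y * v)
      (by simp only [← mul_assoc, hv.star_left hp]) (by simp only [mul_assoc, hv.right])
    convert h using 1
    simp only [he, mul_assoc]
  have h2 : e * y * (p - e) ∈ squareZeroSpan p := by
    refine mem_squareZeroSpan (by simp only [← mul_assoc, hpe])
      (by rw [mul_assoc, sub_mul, hpp, hep]) ?_
    have : (p - e) * e = 0 := by rw [sub_mul, hpe, hee, sub_self]
    calc e * y * (p - e) * (e * y * (p - e)) = e * y * ((p - e) * e) * y * (p - e) := by
          simp only [mul_assoc]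
      _ = 0 := by rw [this]; simp
  have h3 : (p - e) * y * e ∈ squareZeroSpan p := by
    refine mem_squareZeroSpan (by simp only [← mul_assoc, mul_sub, hpp, hpe])
      (by rw [mul_assoc, hep]) ?_
    have : e * (p - e) = 0 := by rw [mul_sub, hep, hee, sub_self]
    calc (p - e) * y * e * ((p - e) * y * e) = (p - e) * y * (e * (p - e)) * y * e := by
          simp only [mul_assoc]
      _ = 0 := by rw [this]; simp
  have h4 : (p - e) * y * (p - e) ∈ squareZeroSpan p := by
    set x := (p - e) * y * (p - e) with hx
    have hpx : p * x = x := by simp only [hx, ← mul_assoc, mul_sub, hpp, hpe]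
    have hxp : x * p = x := by rw [hx, mul_assoc _ _ p, sub_mul p e p, hpp, hep]
    have h := sub_conj_mem_squareZeroSpan (g := v) (h := star v) hv.left (hv.star_right hp) hpx hxp
      (by rw [hx, mul_assoc _ _ v, sub_mul p e v, hv.left, hev, sub_self, mul_zero])
      (by simp only [hx, ← mul_assoc, mul_sub, hv.star_right hp, hve, sub_self, zero_mul])
      (by rw [mul_assoc x, hv.star_mul, hxp])
    have := Submodule.add_mem _ h (conj_mem hpx hxp)
    rwa [sub_add_cancel] at this
  have h5 : y = e * y * e + e * y * (p - e) + (p - e) * y * e + (p - e) * y * (p - e) := by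
    calc y = p * y * p := by rw [hy, hy']
      _ = _ := by noncomm_ring
  rw [h5]
  exact Submodule.add_mem _ (Submodule.add_mem _ (Submodule.add_mem _ h1 h2) h3) h4

end IsCornerIsometry

theorem exists_isCornerIsometry {e : A} (hp : IsStarProjection p)
    (hpe : p * e = e) (h : MurrayVonNeumannEquiv p e) :
    ∃ v : A, IsCornerIsometry p v ∧ v * star v = e := by
  obtain ⟨v, hv, hve⟩ := h
  have hpp : p * p = p := hp.isIdempotentElem.eq
  have hvp : v * p = v := by
    rw [← sub_eq_zero, ← CStarRing.star_mul_self_eq_zero_iff]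
    simp only [star_sub, StarMul.star_mul, hp.isSelfAdjoint.star_eq, mul_sub, sub_mul, mul_assoc, hv]
    simp only [← mul_assoc, hv, hpp, sub_self]
  have hev : e * v = v := by rw [← hve, mul_assoc, hv, hvp]
  exact ⟨v, ⟨hv, by rw [← hev, ← mul_assoc, hpe], hvp⟩, hve⟩

/-- The corner of a properly infinite projection is spanned by elements of square zero. -/
theorem IsProperlyInfiniteProjection.corner_mem_squareZeroSpan
    (hp : IsProperlyInfiniteProjection p) {y : A} (hy : y ∈ Subsemigroup.corner p) :
    y ∈ squareZeroSpan p := by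
  obtain ⟨e, f, -, -, hpe, hpf, hef, hpe', hpf'⟩ := hp.exists_orthogonal
  have hP := hp.isStarProjection
  obtain ⟨u, hu, hue⟩ := exists_isCornerIsometry hP hpe hpe'
  obtain ⟨v, hv, hvf⟩ := exists_isCornerIsometry hP hpf hpf'
  rw [Subsemigroup.mem_corner_iff hP.isIdempotentElem] at hy
  refine IsCornerIsometry.corner_mem_squareZeroSpan hP hu hv ?_ hy.1 hy.2
  calc star u * v = star u * (u * star u) * (v * star v) * v := by
        rw [mul_assoc _ _ v, mul_assoc v, hv.star_mul, hv.right, ← mul_assoc (star u),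
          hu.star_mul, hu.star_left hP]
    _ = 0 := by rw [hue, hvf, mul_assoc (star u), hef]; simp

end ProperlyInfinite

/-! ### Anticommutation on orthogonal corners. -/

theorem proposition4p1 {A B : Type*} [CStarAlgebra A]
    [NormedRing B] [NormedAlgebra ℂ B] [CompleteSpace B]
    (hB : Ring.jacobson B = ⊥)
    (T : A →ₗ[ℂ] B) (hT : IsSpectrallyBounded T) (hsurj : Function.Surjective T)
    (p q : A) (hp : IsProperlyInfiniteProjection p) (hq : IsProperlyInfiniteProjection q)
    (hpq : p * q = 0) :
    ∀ a ∈ Subsemigroup.corner p, ∀ b ∈ Subsemigroup.corner q, T a * T b + T b * T a = 0 := by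
  intro a ha b hb
  have hqp : q * p = 0 := by
    simpa [hp.isStarProjection.isSelfAdjoint.star_eq, hq.isStarProjection.isSelfAdjoint.star_eq]
      using congrArg star hpq
  have hsq := fun {x : A} (hx : x * x = 0) => hT.map_mul_self_eq_zero hB hsurj hx
  replace ha := hp.corner_mem_squareZeroSpan ha
  replace hb := hq.corner_mem_squareZeroSpan hb
  induction ha using Submodule.span_induction with
  | zero => simp
  | add x y _ _ hx hy =>
    rw [map_add, add_mul, mul_add, add_add_add_comm, hx, hy, add_zero]
  | smul k x _ hx => rw [map_smul, smul_mul_assoc, mul_smul_comm, ← smul_add, hx, smul_zero]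
  | mem x hx =>
    induction hb using Submodule.span_induction with
    | zero => simp
    | add y z _ _ hy hz =>
      rw [map_add, add_mul, mul_add, add_add_add_comm, hy, hz, add_zero]
    | smul k y _ hy => rw [map_smul, smul_mul_assoc, mul_smul_comm, ← smul_add, hy, smul_zero]
    | mem y hy =>
      obtain ⟨hpx, hxp, hxx⟩ := hx
      obtain ⟨hqy, hyq, hyy⟩ := hy
      have hxy : x * y = 0 := by
        rw [← hxp, ← hqy, mul_assoc, ← mul_assoc p, hpq, zero_mul, mul_zero]
      have hyx : y * x = 0 := by
        rw [← hyq, ← hpx, mul_assoc, ← mul_assoc q, hqp, zero_mul, mul_zero]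
      have h := hsq (x := x + y) (by simp [add_mul, mul_add, hxx, hxy, hyx, hyy])
      rw [map_add, add_mul, mul_add, mul_add, hsq hxx, hsq hyy, zero_add, add_zero] at h
      exact h
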